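/- Let $\tau=\langle <,S;\mathsf{min},\mathsf{max}\rangle$ be the vocabulary with a binary relation symbol $<$, a unary relation symbol $S$ and two constant symbols. For $n\ge 1$, a string $w=(w_1,\dots,w_n)\in\{0,1\}^n$ is identified with the $\tau$-structure with universe $\{1,\dots,n\}$ in which $<$ is the natural order, $S=\{i: w_i=1\}$, $\mathsf{min}=1$ and $\mathsf{max}=n$. A first-order $\tau$-sentence $\varphi$ separates $(A,B)$, where $A,B\subseteq\{0,1\}^n$, if $\varphi$ is true in every $w\in A$ and false in every $w\in B$; it defines $f:\{0,1\}^n\to\{0,1\}$ if it separates $(f^{-1}(1),f^{-1}(0))$. Write $\log$ for the logarithm to base $2$, and count every occurrence of a quantifier in a sentence. (1) For every $\varepsilon>0$ there is a constant $C_\varepsilon$, depending only on $\varepsilon$, such that for every $n\ge 1$ every Boolean function $f:\{0,1\}^n\to\{0,1\}$ is defined by a first-order $\tau$-sentence with at most $(1+\varepsilon)\frac{n}{\log n}+C_\varepsilon$ quantifiers (for $n=1$ the quotient $n/\log n$ is read as $0$). (2) For all sufficiently large $n$ there is a set $A$ with $\emptyset\ne A\subsetneq\{0,1\}^n$ such that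 every first-order $\tau$-sentence separating $(A,\{0,1\}^n\setminus A)$ has at least $\frac{n}{\log n}$ quantifiers. -/

import Mathlib

/-- Function symbols of the vocabulary of binary strings: the two constants `min` and `max`. -/
inductive StrFunc : ℕ → Type
  | min : StrFunc 0
  | max : StrFunc 0

/-- Relation symbols of the vocabulary of binary strings: the binary `<` and the unary `S`. -/
inductive StrRel : ℕ → Type
  | lt : StrRel 2
  | S : StrRel 1

/-- The vocabulary `⟨<, S ; min, max⟩` of binary strings. First-order formulas over it are
Mathlib's, with equality as a logical symbol. -/
def strLang : FirstOrder.Language.{0, 0} := ⟨StrFunc, StrRel⟩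

/-- The structure encoding the `n`-bit string `w` (`n ≥ 1`): the universe is the set of the `n`
positions in their natural order, `S` holds at the positions that carry the bit `1`, and `min`,
`max` are the first and the last position. -/
@[reducible] def strStructure {n : ℕ} [NeZero n] (w : Fin n → Bool) :
    strLang.Structure (Fin n) where
  funMap {_} c _ :=
    match c with
    | StrFunc.min => ⟨0, Nat.pos_of_neZero n⟩
    | StrFunc.max => ⟨n - 1, Nat.sub_lt (Nat.pos_of_neZero n) Nat.one_pos⟩
  RelMap {_} r :=
    match r with
    | StrRel.lt => fun x => x 0 < x 1
    | StrRel.S => fun x => w (x 0) = true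

/-- The string `w` satisfies the sentence `φ`. -/
def StrModels {n : ℕ} [NeZero n] (w : Fin n → Bool) (φ : strLang.Sentence) : Prop :=
  @FirstOrder.Language.Sentence.Realize strLang (Fin n) (strStructure w) φ

/-- The number of occurrences of quantifiers in a formula. The primitive connectives are `⊥`, `→`
and `∀`; the derived `¬`, `∧`, `∨` do not repeat their arguments, and `∃` is `¬ ∀ ¬`, so each `∃`
counts once as well. -/
def quantifierNumber {α : Type} :
    {m : ℕ} → strLang.BoundedFormula α m → ℕ
  | _, .falsum => 0
  | _, .equal _ _ => 0
  | _, .rel _ _ => 0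
  | _, .imp φ ψ => quantifierNumber φ + quantifierNumber ψ
  | _, .all φ => quantifierNumber φ + 1

/-- `φ` is a separating sentence for `(A, B)`: it is true in every string of `A` and false in
every string of `B`. -/
def Separates {n : ℕ} [NeZero n] (φ : strLang.Sentence) (A B : Set (Fin n → Bool)) : Prop :=
  (∀ w ∈ A, StrModels w φ) ∧ ∀ w ∈ B, ¬ StrModels w φ

/-- `φ` defines the Boolean function `f` on `n`-bit strings: it separates `f⁻¹(1)` from
`f⁻¹(0)`. -/
def DefinesFun {n : ℕ} [NeZero n] (φ : strLang.Sentence) (f : (Fin n → Bool) → Bool) : Prop :=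
  Separates φ {w | f w = true} {w | f w = false}

/-! Lower bound, by counting: prenexing keeps the number of quantifiers, and a quantifier-free
formula in `m` variables sees only the order and the bits of the variables and the two constants.
There are at most `(2(m+2))^(m+2)` such types, hence `2` to that power many matrices, and each
quantifier at most doubles the count (`ncard_prenexRelations_le`). For `Q ≤ n / log n` this stays
below the `2^(2^n)` sets of strings.

Upper bound: fix `K + 1` positions `p` with consecutive gaps at most `b`, and give each string `w`
its own permutation `σ w` of `K + 1` variables, possible once `2^n ≤ (K+1)!`. The sentence is `∃ x ∀
z` with `b` variables `z`, and says that `(x, z)` has the type of `(p ∘ σ w, z')` in `w`, for some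
`z'` and some `w` with `f w = true`. The matrix may pick another `w` for each `z`, but the order of
`x` encodes `w`, so `w` is the same throughout. The `z` then probe one gap at a time, which forces
`x` onto the chosen positions and the string to equal `w` (`Matches.eq`). With `K` about `(1 + ε/2)
n / log n` and `b` about `log n`, the total is `(1 + ε) n / log n`. -/

open FirstOrder Language in
/-- The formula `φ` holds in the string `w` under the assignment `xs`. -/
def SatAt {n m : ℕ} [NeZero n] (w : Fin n → Bool) (φ : strLang.BoundedFormula Empty m)
    (xs : Fin m → Fin n) : Prop :=
  @BoundedFormula.Realize strLang (Fin n) (strStructure w) Empty m φ default xs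

theorem strModels_iff_satAt {n : ℕ} [NeZero n] (w : Fin n → Bool) (φ : strLang.Sentence)
    (xs : Fin 0 → Fin n) : StrModels w φ ↔ SatAt w φ xs := by
  unfold StrModels SatAt FirstOrder.Language.Sentence.Realize FirstOrder.Language.Formula.Realize
  exact iff_of_eq (congrArg₂ _ (Subsingleton.elim _ _) (Subsingleton.elim _ _))

/-! ### Prenex form and the number of quantifiers -/

namespace FirstOrder.Language.BoundedFormula

theorem quantifierNumber_ex {α : Type} {m : ℕ} (φ : strLang.BoundedFormula α (m + 1)) :
    quantifierNumber φ.ex = quantifierNumber φ + 1 := by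
  rfl

theorem quantifierNumber_castLE {α : Type} {m k : ℕ} (h : m ≤ k)
    (φ : strLang.BoundedFormula α m) : quantifierNumber (φ.castLE h) = quantifierNumber φ := by
  induction φ generalizing k with
  | falsum => rfl
  | equal => rfl
  | rel => rfl
  | imp _ _ h₁ h₂ => simp [castLE, quantifierNumber, h₁, h₂]
  | all _ ih => simp [castLE, quantifierNumber, ih]

theorem quantifierNumber_liftAt {α : Type} {m : ℕ} (k l : ℕ)
    (φ : strLang.BoundedFormula α m) : quantifierNumber (φ.liftAt k l) = quantifierNumber φ := by
  induction φ with
  | falsum => rfl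
  | equal => rfl
  | rel => rfl
  | imp _ _ h₁ h₂ =>
    simp only [liftAt, mapTermRel, quantifierNumber] at h₁ h₂ ⊢
    rw [h₁, h₂]
  | all _ ih =>
    simp only [liftAt, mapTermRel, quantifierNumber] at ih ⊢
    rw [quantifierNumber_castLE, ih]

theorem IsQF.quantifierNumber_eq_zero {α : Type} {m : ℕ} {φ : strLang.BoundedFormula α m}
    (h : φ.IsQF) : quantifierNumber φ = 0 := by
  induction h with
  | falsum => rfl
  | of_isAtomic h => cases h <;> rfl
  | imp _ _ h₁ h₂ => simp [quantifierNumber, h₁, h₂]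

theorem quantifierNumber_toPrenexImpRight {α : Type} {m : ℕ}
    {φ ψ : strLang.BoundedFormula α m} (hψ : ψ.IsPrenex) :
    quantifierNumber (φ.toPrenexImpRight ψ) = quantifierNumber φ + quantifierNumber ψ := by
  induction hψ with
  | of_isQF hψ => rw [hψ.toPrenexImpRight]; rfl
  | all _ ih =>
    simp only [toPrenexImpRight, quantifierNumber, ih, quantifierNumber_liftAt]
    rfl
  | ex _ ih =>
    unfold toPrenexImpRight
    rw [quantifierNumber_ex, ih, quantifierNumber_liftAt, quantifierNumber_ex]
    rfl

theorem quantifierNumber_toPrenexImp {α : Type} {m : ℕ}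
    {φ ψ : strLang.BoundedFormula α m} (hφ : φ.IsPrenex) (hψ : ψ.IsPrenex) :
    quantifierNumber (φ.toPrenexImp ψ) = quantifierNumber φ + quantifierNumber ψ := by
  induction hφ with
  | of_isQF hφ => rw [hφ.toPrenexImp, quantifierNumber_toPrenexImpRight hψ]
  | all _ ih =>
    unfold toPrenexImp
    rw [quantifierNumber_ex, ih hψ.liftAt, quantifierNumber_liftAt, quantifierNumber]
    omega
  | ex _ ih =>
    unfold toPrenexImp
    rw [quantifierNumber, ih hψ.liftAt, quantifierNumber_liftAt, quantifierNumber_ex]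
    omega

/-- Pulling a quantifier out of an implication may swap `∀` and `∃` but never duplicates it. -/
theorem quantifierNumber_toPrenex {α : Type} {m : ℕ} (φ : strLang.BoundedFormula α m) :
    quantifierNumber φ.toPrenex = quantifierNumber φ := by
  induction φ with
  | falsum => rfl
  | equal => rfl
  | rel => rfl
  | imp f g hf hg =>
    rw [toPrenex, quantifierNumber_toPrenexImp f.toPrenex_isPrenex g.toPrenex_isPrenex, hf, hg,
      quantifierNumber]
  | all _ ih => rw [toPrenex, quantifierNumber, ih, quantifierNumber]

end FirstOrder.Language.BoundedFormula

/-! ### Quantifier-free types -/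

/-- The positions denoted by the variables and by the two constants. -/
def termPos {n m : ℕ} [NeZero n] (xs : Fin m → Fin n) (i : Fin (m + 2)) : Fin n :=
  Fin.append xs ![⟨0, Nat.pos_of_neZero n⟩, ⟨n - 1, Nat.sub_lt (Nat.pos_of_neZero n) Nat.one_pos⟩] i

/-- The quantifier-free type of an assignment: for each variable and constant, its rank among
them all and the bit at its position. -/
noncomputable def qfType {n m : ℕ} [NeZero n] (w : Fin n → Bool) (xs : Fin m → Fin n) (i : Fin (m + 2)) :
    Fin (m + 2) × Bool :=
  (⟨{j | termPos xs j < termPos xs i}.ncard, by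
      have : {j | termPos xs j < termPos xs i} ⊂ Set.univ :=
        (Set.ssubset_univ_iff).2 fun h => lt_irrefl (termPos xs i) (h.ge (Set.mem_univ i))
      simpa using Set.ncard_lt_ncard this⟩,
    w (termPos xs i))

theorem lt_iff_qfType_lt {n m : ℕ} [NeZero n] (w : Fin n → Bool) (xs : Fin m → Fin n)
    (i j : Fin (m + 2)) :
    termPos xs i < termPos xs j ↔ (qfType w xs i).1 < (qfType w xs j).1 := by
  constructor
  · intro h
    refine Set.ncard_lt_ncard (Set.ssubset_iff_exists.2 ⟨fun k hk => ?_, i, h, ?_⟩)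
    · exact lt_trans hk h
    · exact fun h => lt_irrefl (termPos xs i) h
  · intro h
    by_contra! hle
    exact absurd h (not_lt.2 (Set.ncard_le_ncard fun k hk => lt_of_lt_of_le hk hle))

theorem lt_iff_of_qfType_eq {n m : ℕ} [NeZero n] {w v : Fin n → Bool} {xs ys : Fin m → Fin n}
    (h : qfType w xs = qfType v ys) (i j : Fin (m + 2)) :
    termPos xs i < termPos xs j ↔ termPos ys i < termPos ys j := by
  rw [lt_iff_qfType_lt w, lt_iff_qfType_lt v, h]

theorem bit_eq_of_qfType_eq {n m : ℕ} [NeZero n] {w v : Fin n → Bool} {xs ys : Fin m → Fin n}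
    (h : qfType w xs = qfType v ys) (i : Fin (m + 2)) :
    w (termPos xs i) = v (termPos ys i) :=
  congrArg Prod.snd (congrFun h i)

-- The vocabulary has no function symbols of positive arity, so terms do not nest, and the index
-- does not depend on the string.
open FirstOrder Language in
theorem exists_termPos {m : ℕ} (t : strLang.Term (Empty ⊕ Fin m)) :
    ∃ i : Fin (m + 2), ∀ {n : ℕ} [NeZero n] (w : Fin n → Bool) (xs : Fin m → Fin n),
      @Term.realize strLang (Fin n) (strStructure w) _ (Sum.elim default xs) t = termPos xs i := by
  cases t with
  | var a =>
    rcases a with a | a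
    · exact a.elim
    · exact ⟨Fin.castAdd 2 a, fun w xs => by simp [termPos]⟩
  | func f ts =>
    cases f with
    | min => exact ⟨Fin.natAdd m 0, fun w xs => by simp [termPos]; rfl⟩
    | max => exact ⟨Fin.natAdd m 1, fun w xs => by simp [termPos]; rfl⟩

open FirstOrder Language in
theorem satAt_iff_of_qfType_eq {n m : ℕ} [NeZero n] {φ : strLang.BoundedFormula Empty m}
    (hφ : φ.IsQF) {w v : Fin n → Bool} {xs ys : Fin m → Fin n} (h : qfType w xs = qfType v ys) :
    SatAt w φ xs ↔ SatAt v φ ys := by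
  induction hφ with
  | falsum => exact Iff.rfl
  | imp _ _ h₁ h₂ => exact imp_congr h₁ h₂
  | of_isAtomic ha =>
    cases ha with
    | equal t₁ t₂ =>
      obtain ⟨i, hi⟩ := exists_termPos t₁
      obtain ⟨j, hj⟩ := exists_termPos t₂
      have key := lt_iff_of_qfType_eq h
      unfold SatAt
      rw [@BoundedFormula.realize_bdEqual _ _ (strStructure w),
        @BoundedFormula.realize_bdEqual _ _ (strStructure v), hi, hj, hi, hj]
      simp only [le_antisymm_iff, ← not_lt, key]
    | rel R ts =>
      choose i hi using fun k => exists_termPos (ts k)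
      unfold SatAt
      rw [@BoundedFormula.realize_rel _ _ (strStructure w),
        @BoundedFormula.realize_rel _ _ (strStructure v)]
      simp only [hi]
      cases R with
      | lt => exact lt_iff_of_qfType_eq h _ _
      | S =>
        change w _ = true ↔ v _ = true
        rw [bit_eq_of_qfType_eq h]

/-! ### Counting definable sets -/

open FirstOrder Language in
/-- The relations on `n`-bit strings with `m` marked positions that are defined by prenex formulas
with exactly `k` quantifiers. -/
def prenexRelations (n : ℕ) [NeZero n] (m k : ℕ) : Set (Set ((Fin n → Bool) × (Fin m → Fin n))) :=
  {R | ∃ φ : strLang.BoundedFormula Empty m, φ.IsPrenex ∧ quantifierNumber φ = k ∧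
    R = {p | SatAt p.1 φ p.2}}

/-- A quantifier-free relation is a union of type classes, so it is determined by a set of types. -/
theorem ncard_prenexRelations_zero_le (n : ℕ) [NeZero n] (m : ℕ) :
    (prenexRelations n m 0).ncard ≤ 2 ^ ((2 * (m + 2)) ^ (m + 2)) := by
  classical
  have hsub : prenexRelations n m 0 ⊆
      (fun T : Set (Fin (m + 2) → Fin (m + 2) × Bool) =>
        {p : (Fin n → Bool) × (Fin m → Fin n) | qfType p.1 p.2 ∈ T}) '' Set.univ := by
    rintro R ⟨φ, hφ, hq, rfl⟩
    have hqf : φ.IsQF := by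
      cases hφ with
      | of_isQF h => exact h
      | all _ => simp [quantifierNumber] at hq
      | ex _ => rw [FirstOrder.Language.BoundedFormula.quantifierNumber_ex] at hq; omega
    refine ⟨{t | ∃ p : (Fin n → Bool) × (Fin m → Fin n), SatAt p.1 φ p.2 ∧ qfType p.1 p.2 = t},
      Set.mem_univ _, ?_⟩
    ext p
    constructor
    · rintro ⟨q, hq, h⟩
      exact (satAt_iff_of_qfType_eq hqf h).1 hq
    · exact fun h => ⟨p, h, rfl⟩
  calc _ ≤ _ := Set.ncard_le_ncard hsub (Set.toFinite _)
    _ ≤ _ := Set.ncard_image_le (Set.toFinite _)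
    _ = _ := by simp [Set.ncard_univ, mul_comm]

/-- Stripping the outermost quantifier leaves a relation with one more marked position; the choice
between `∀` and `∃` costs the factor 2. -/
theorem ncard_prenexRelations_le (n : ℕ) [NeZero n] (m k : ℕ) :
    (prenexRelations n m k).ncard ≤ 2 ^ k * 2 ^ ((2 * (m + k + 2)) ^ (m + k + 2)) := by
  induction k generalizing m with
  | zero => simpa using ncard_prenexRelations_zero_le n m
  | succ k ih =>
    have hsub : prenexRelations n m (k + 1) ⊆
        (fun R : Set ((Fin n → Bool) × (Fin (m + 1) → Fin n)) =>
          {p : (Fin n → Bool) × (Fin m → Fin n) | ∀ a, (p.1, Fin.snoc p.2 a) ∈ R}) ''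
            prenexRelations n (m + 1) k ∪
        (fun R : Set ((Fin n → Bool) × (Fin (m + 1) → Fin n)) =>
          {p : (Fin n → Bool) × (Fin m → Fin n) | ∃ a, (p.1, Fin.snoc p.2 a) ∈ R}) ''
            prenexRelations n (m + 1) k := by
      rintro R ⟨φ, hφ, hq, rfl⟩
      cases hφ with
      | of_isQF h => rw [h.quantifierNumber_eq_zero] at hq; omega
      | all h =>
        exact Or.inl ⟨_, ⟨_, h, by simpa [quantifierNumber] using hq, rfl⟩, rfl⟩
      | ex h =>
        rw [FirstOrder.Language.BoundedFormula.quantifierNumber_ex] at hq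
        refine Or.inr ⟨_, ⟨_, h, by omega, rfl⟩, ?_⟩
        ext p
        exact (@FirstOrder.Language.BoundedFormula.realize_ex _ _ (strStructure p.1) _ _ _ _ _).symm
    have h := ih (m + 1)
    calc _ ≤ _ := Set.ncard_le_ncard hsub (Set.toFinite _)
      _ ≤ _ := Set.ncard_union_le _ _
      _ ≤ _ := add_le_add (Set.ncard_image_le (Set.toFinite _)) (Set.ncard_image_le (Set.toFinite _))
      _ ≤ _ := add_le_add h h
      _ = _ := by rw [show m + 1 + k = m + (k + 1) by omega]; ring

/-- The sets of `n`-bit strings defined by sentences with exactly `k` quantifiers. -/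
def definableSets (n : ℕ) [NeZero n] (k : ℕ) : Set (Set (Fin n → Bool)) :=
  {A | ∃ φ : strLang.Sentence, quantifierNumber φ = k ∧ A = {w | StrModels w φ}}

theorem ncard_definableSets_le (n : ℕ) [NeZero n] (k : ℕ) :
    (definableSets n k).ncard ≤ 2 ^ k * 2 ^ ((2 * (k + 2)) ^ (k + 2)) := by
  have hsub : definableSets n k ⊆
      (fun R : Set ((Fin n → Bool) × (Fin 0 → Fin n)) => {w | (w, default) ∈ R}) ''
        prenexRelations n 0 k := by
    rintro A ⟨φ, hq, rfl⟩
    refine ⟨_, ⟨FirstOrder.Language.BoundedFormula.toPrenex φ,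
      FirstOrder.Language.BoundedFormula.toPrenex_isPrenex φ,
      by rw [FirstOrder.Language.BoundedFormula.quantifierNumber_toPrenex, hq], rfl⟩, ?_⟩
    ext w
    exact (@FirstOrder.Language.BoundedFormula.realize_toPrenex strLang (Fin n) (strStructure w) _ _
      _ φ _ _).trans (strModels_iff_satAt w φ _).symm
  have h := ncard_prenexRelations_le n 0 k
  simp only [zero_add] at h
  exact (Set.ncard_le_ncard hsub (Set.toFinite _)).trans
    ((Set.ncard_image_le (Set.toFinite _)).trans h)

theorem ncard_iUnion_definableSets_le (n : ℕ) [NeZero n] (Q : ℕ) :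
    (⋃ k ∈ Finset.range (Q + 1), definableSets n k).ncard ≤
      2 ^ (2 * Q + (2 * (Q + 2)) ^ (Q + 2)) := by
  calc _ ≤ ∑ k ∈ Finset.range (Q + 1), (definableSets n k).ncard := Finset.set_ncard_biUnion_le _ _
    _ ≤ ∑ k ∈ Finset.range (Q + 1), 2 ^ Q * 2 ^ ((2 * (Q + 2)) ^ (Q + 2)) := by
      refine Finset.sum_le_sum fun k hk => (ncard_definableSets_le n k).trans ?_
      have hk : k ≤ Q := by simpa [Nat.lt_succ_iff] using hk
      have h₁ : (2 * (k + 2)) ^ (k + 2) ≤ (2 * (Q + 2)) ^ (Q + 2) :=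
        (Nat.pow_le_pow_left (by omega) _).trans (Nat.pow_le_pow_right (by omega) (by omega))
      exact Nat.mul_le_mul (Nat.pow_le_pow_right two_pos hk) (Nat.pow_le_pow_right two_pos h₁)
    _ = (Q + 1) * (2 ^ Q * 2 ^ ((2 * (Q + 2)) ^ (Q + 2))) := by simp
    _ ≤ 2 ^ Q * (2 ^ Q * 2 ^ ((2 * (Q + 2)) ^ (Q + 2))) :=
      Nat.mul_le_mul_right _ Nat.lt_two_pow_self
    _ = _ := by rw [two_mul Q, pow_add 2, pow_add 2, mul_assoc]

/-- By counting, some set of `n`-bit strings needs more than `Q` quantifiers. -/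
theorem exists_not_definable (n : ℕ) [NeZero n] (Q : ℕ)
    (h : 2 * Q + (2 * (Q + 2)) ^ (Q + 2) < 2 ^ n) :
    ∃ A : Set (Fin n → Bool), A.Nonempty ∧ A ≠ Set.univ ∧
      ∀ φ : strLang.Sentence, Separates φ A Aᶜ → Q < quantifierNumber φ := by
  classical
  obtain ⟨A, hA⟩ : ∃ A, A ∉ ⋃ k ∈ Finset.range (Q + 1), definableSets n k := by
    by_contra! hall
    have h₁ := ncard_iUnion_definableSets_le n Q
    rw [Set.eq_univ_of_forall hall] at h₁
    have h₂ : (Set.univ : Set (Set (Fin n → Bool))).ncard = 2 ^ 2 ^ n := by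
      simp [Set.ncard_univ]
    rw [h₂] at h₁
    exact absurd (Nat.pow_lt_pow_right one_lt_two h) (not_lt.2 h₁)
  have key : ∀ φ : strLang.Sentence, A = {w | StrModels w φ} → Q < quantifierNumber φ := by
    intro φ hφ
    by_contra! hle
    exact hA (Set.mem_biUnion (by simpa [Nat.lt_succ_iff] using hle) ⟨φ, rfl, hφ⟩)
  -- The empty and the full set are excluded because `⊥` and `⊥ → ⊥` define them without
  -- quantifiers.
  refine ⟨A, Set.nonempty_iff_ne_empty.2 ?_, ?_, fun φ hφ => key φ ?_⟩
  · rintro rfl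
    refine absurd (key ⊥ ?_) (Nat.not_lt_zero _)
    ext w
    exact Iff.rfl
  · rintro rfl
    refine absurd (key (.imp ⊥ ⊥) ?_) (Nat.not_lt_zero _)
    ext w
    exact ⟨fun _ => id, fun _ => trivial⟩
  · ext w
    exact ⟨hφ.1 w, fun hw => by_contra fun h => hφ.2 w h hw⟩

-- With `l = log n`, the base is at most `n / 2 = 2^(l-1)`, and `(l-1)(n/l + 2) = n - n/l + 2l - 2 ≤
-- n - 2`. The power is thus at most `2^n / 4`, and so is `2Q`. The threshold `2^64` gives the crude
-- inequality for the base.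
open Real Filter in
theorem eventually_floor_pow_lt :
    ∀ᶠ n : ℕ in atTop, ∀ Q : ℕ, (Q : ℝ) ≤ n / logb 2 n →
      2 * Q + (2 * (Q + 2)) ^ (Q + 2) < 2 ^ n := by
  have hlog : (fun x : ℝ => log x) =o[atTop] fun x => x ^ (1 / 2 : ℝ) :=
    isLittleO_log_rpow_atTop (by norm_num)
  have h₁ : ∀ᶠ n : ℕ in atTop, log (n : ℝ) ≤ (log 2 / 2) * (n : ℝ) ^ (1 / 2 : ℝ) := by
    have := hlog.bound (c := log 2 / 2) (by positivity)
    filter_upwards [tendsto_natCast_atTop_atTop.eventually this, eventually_ge_atTop 1] with n hn h1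
    rw [norm_of_nonneg (log_nonneg (by exact_mod_cast h1)), norm_of_nonneg (by positivity)] at hn
    exact hn
  filter_upwards [h₁, eventually_ge_atTop (2 ^ 64)] with n hn hbig Q hQ
  have hnR : (2 : ℝ) ^ 64 ≤ n := by exact_mod_cast hbig
  have hnpos : (0 : ℝ) < n := by linarith [show (0 : ℝ) < 2 ^ 64 by positivity]
  set l := logb 2 (n : ℝ) with hl
  have hl64 : 64 ≤ l := by
    rw [hl, le_logb_iff_rpow_le one_lt_two hnpos]
    exact_mod_cast hbig
  have hlsq : 4 * l ^ 2 ≤ n := by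
    have h2 : 2 * l ≤ (n : ℝ) ^ (1 / 2 : ℝ) := by
      rw [hl, logb, mul_div_assoc', div_le_iff₀ (log_pos one_lt_two)]
      linarith
    have h3 : ((n : ℝ) ^ (1 / 2 : ℝ)) ^ 2 = n := by
      rw [← rpow_natCast, ← rpow_mul hnpos.le]; norm_num
    nlinarith
  have hnl : n / l ≤ n / 64 := by gcongr
  have hnl2 : 4 * l ≤ n / l := by
    rw [le_div_iff₀ (by linarith)]; nlinarith
  have hbase : (2 * ((Q : ℝ) + 2)) ≤ n / 2 := by linarith
  have hpow : (2 * ((Q : ℝ) + 2)) ^ (Q + 2) ≤ 2 ^ ((n : ℝ) - 2) := by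
    have hn2 : (n : ℝ) / 2 = 2 ^ (l - 1) := by
      rw [rpow_sub two_pos, rpow_logb two_pos (by norm_num) hnpos, rpow_one]
    calc (2 * ((Q : ℝ) + 2)) ^ (Q + 2) ≤ (2 ^ (l - 1)) ^ (Q + 2) := by
          rw [← hn2]; gcongr
      _ = 2 ^ ((l - 1) * ((Q + 2 : ℕ) : ℝ)) := by rw [← rpow_natCast, ← rpow_mul two_pos.le]
      _ ≤ _ := by
        apply rpow_le_rpow_of_exponent_le one_le_two
        push_cast
        have : (l - 1) * ((Q : ℝ) + 2) ≤ (l - 1) * (n / l + 2) := by gcongr; linarith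
        have h4 : l * (n / l) = n := by field_simp
        nlinarith
  have hQle : 2 * (Q : ℝ) ≤ (2 * ((Q : ℝ) + 2)) ^ (Q + 2) := by
    calc 2 * (Q : ℝ) ≤ 2 * ((Q : ℝ) + 2) := by linarith
      _ ≤ _ := le_self_pow₀ (by nlinarith [(Nat.cast_nonneg Q : (0 : ℝ) ≤ Q)]) (by omega)
  have h4 : (2 : ℝ) ^ ((n : ℝ) - 2) = 2 ^ n / 4 := by
    rw [rpow_sub two_pos, rpow_natCast]; norm_num
  have : (0 : ℝ) < 2 ^ n := by positivity
  have : 2 * (Q : ℝ) + (2 * ((Q : ℝ) + 2)) ^ (Q + 2) < 2 ^ n := by linarith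
  exact_mod_cast this

theorem lower_bound :
    ∃ N : ℕ, ∀ (n : ℕ) [NeZero n], N ≤ n →
      ∃ A : Set (Fin n → Bool), A.Nonempty ∧ A ≠ Set.univ ∧
        ∀ φ : strLang.Sentence, Separates φ A Aᶜ →
          (n : ℝ) / Real.logb 2 (n : ℝ) ≤ (quantifierNumber φ : ℝ) := by
  obtain ⟨N, hN⟩ := Filter.eventually_atTop.1 eventually_floor_pow_lt
  refine ⟨N, fun n _ hn => ?_⟩
  have hn1 : (1 : ℝ) ≤ n := by exact_mod_cast Nat.pos_of_neZero n
  have hnn : 0 ≤ (n : ℝ) / Real.logb 2 n :=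
    div_nonneg (by linarith) (Real.logb_nonneg one_lt_two hn1)
  obtain ⟨A, h₁, h₂, h₃⟩ := exists_not_definable n ⌊(n : ℝ) / Real.logb 2 n⌋₊
    (hN n hn _ (Nat.floor_le hnn))
  refine ⟨A, h₁, h₂, fun φ hφ => ((Nat.floor_lt hnn).1 (h₃ φ hφ)).le⟩

/-! ### Building sentences from types -/

/-- The relation `R` is defined on `n`-bit strings by a quantifier-free formula. -/
def QFDefinable {n m : ℕ} [NeZero n] (R : (Fin n → Bool) → (Fin m → Fin n) → Prop) : Prop :=
  ∃ φ : strLang.BoundedFormula Empty m, quantifierNumber φ = 0 ∧ ∀ w xs, SatAt w φ xs ↔ R w xs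

namespace QFDefinable

variable {n m : ℕ} [NeZero n] {R R' : (Fin n → Bool) → (Fin m → Fin n) → Prop}

theorem congr (h : QFDefinable R) (h' : ∀ w xs, R w xs ↔ R' w xs) : QFDefinable R' := by
  obtain ⟨φ, hq, hφ⟩ := h
  exact ⟨φ, hq, fun w xs => (hφ w xs).trans (h' w xs)⟩

theorem false : QFDefinable fun (_ : Fin n → Bool) (_ : Fin m → Fin n) => False :=
  ⟨.falsum, rfl, fun _ _ => Iff.rfl⟩

theorem imp (h : QFDefinable R) (h' : QFDefinable R') :
    QFDefinable fun w xs => R w xs → R' w xs := by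
  obtain ⟨φ, hq, hφ⟩ := h
  obtain ⟨φ', hq', hφ'⟩ := h'
  exact ⟨φ.imp φ', by simp [quantifierNumber, hq, hq'],
    fun w xs => imp_congr (hφ w xs) (hφ' w xs)⟩

theorem not (h : QFDefinable R) : QFDefinable fun w xs => ¬ R w xs := h.imp .false

theorem and (h : QFDefinable R) (h' : QFDefinable R') :
    QFDefinable fun w xs => R w xs ∧ R' w xs :=
  (h.imp h'.not).not.congr fun w xs => by tauto

theorem iff_const (h : QFDefinable R) (c : Prop) : QFDefinable fun w xs => R w xs ↔ c := by
  by_cases hc : c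
  · simpa [hc] using h
  · simpa [hc] using h.not

theorem forall_of_finite {ι : Type*} [Finite ι]
    {S : ι → (Fin n → Bool) → (Fin m → Fin n) → Prop} (h : ∀ i, QFDefinable (S i)) :
    QFDefinable fun w xs => ∀ i, S i w xs := by
  classical
  cases nonempty_fintype ι
  suffices ∀ s : Finset ι, QFDefinable fun w xs => ∀ i ∈ s, S i w xs by
    simpa using this Finset.univ
  intro s
  induction s using Finset.induction_on with
  | empty => simpa using (QFDefinable.false (n := n) (m := m)).not
  | insert a s _ ih => simpa using (h a).and ih

theorem exists_of_finite {ι : Type*} [Finite ι]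
    {S : ι → (Fin n → Bool) → (Fin m → Fin n) → Prop} (h : ∀ i, QFDefinable (S i)) :
    QFDefinable fun w xs => ∃ i, S i w xs :=
  (forall_of_finite fun i => (h i).not).not.congr fun w xs => by simp

theorem lt (i j : Fin m) : QFDefinable fun (_ : Fin n → Bool) (xs : Fin m → Fin n) => xs i < xs j :=
  ⟨.rel StrRel.lt ![.var (Sum.inr i), .var (Sum.inr j)], rfl, fun _ _ => Iff.rfl⟩

theorem bit (i : Fin m) : QFDefinable fun (w : Fin n → Bool) (xs : Fin m → Fin n) =>
    w (xs i) = true :=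
  ⟨.rel StrRel.S ![.var (Sum.inr i)], rfl, fun _ _ => Iff.rfl⟩

end QFDefinable

/-- Two assignments order the variables in the same way and put them on equal bits. -/
def SameType {n m : ℕ} (w : Fin n → Bool) (xs : Fin m → Fin n) (v : Fin n → Bool)
    (ys : Fin m → Fin n) : Prop :=
  (∀ i j, xs i < xs j ↔ ys i < ys j) ∧ ∀ i, w (xs i) = v (ys i)

theorem SameType.refl {n m : ℕ} (w : Fin n → Bool) (xs : Fin m → Fin n) : SameType w xs w xs :=
  ⟨fun _ _ => Iff.rfl, fun _ => rfl⟩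

theorem qfDefinable_sameType {n m : ℕ} [NeZero n] (v : Fin n → Bool) (ys : Fin m → Fin n) :
    QFDefinable fun w xs => SameType w xs v ys := by
  refine (QFDefinable.forall_of_finite fun i => QFDefinable.forall_of_finite fun j =>
    (QFDefinable.lt i j).iff_const _).and (QFDefinable.forall_of_finite fun i => ?_)
  refine ((QFDefinable.bit i).iff_const (v (ys i) = true)).congr fun w xs => ?_
  exact Bool.eq_iff_iff.symm

theorem append_snoc {k b : ℕ} {α : Type*} (x : Fin k → α) (z : Fin b → α) (a : α) :
    Fin.append x (Fin.snoc z a : Fin (b + 1) → α) = Fin.snoc (Fin.append x z) a := by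
  funext i
  refine Fin.lastCases ?_ (fun i => ?_) i
  · rw [Fin.snoc_last]
    exact (Fin.append_right x _ (Fin.last b)).trans (Fin.snoc_last _ _)
  · rw [Fin.snoc_castSucc]
    refine Fin.addCases (fun i => ?_) (fun i => ?_) i
    · rw [Fin.append_left]
      exact Fin.append_left x _ i
    · rw [Fin.append_right]
      exact (Fin.append_right x _ i.castSucc).trans (Fin.snoc_castSucc _ _ _)

open FirstOrder Language in
theorem exists_forall_block {k b : ℕ} (φ : strLang.BoundedFormula Empty (k + b)) :
    ∃ ψ : strLang.BoundedFormula Empty k, quantifierNumber ψ = quantifierNumber φ + b ∧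
      ∀ {n : ℕ} [NeZero n] (w : Fin n → Bool) (x : Fin k → Fin n),
        SatAt w ψ x ↔ ∀ z : Fin b → Fin n, SatAt w φ (Fin.append x z) := by
  induction b with
  | zero =>
    refine ⟨φ, rfl, fun w x => ⟨fun h z => ?_, fun h => ?_⟩⟩
    · rwa [Subsingleton.elim z Fin.elim0, Fin.append_elim0]
    · have := h Fin.elim0
      rwa [Fin.append_elim0] at this
  | succ b ih =>
    obtain ⟨ψ, hq, hψ⟩ := ih (BoundedFormula.all φ)
    refine ⟨ψ, by rw [hq, quantifierNumber]; omega, fun {n} _ w x => (hψ w x).trans ?_⟩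
    have hall : ∀ z : Fin b → Fin n, SatAt w (BoundedFormula.all φ) (Fin.append x z) ↔
        ∀ a, SatAt w φ (Fin.snoc (Fin.append x z) a) := fun z => Iff.rfl
    simp only [hall, ← append_snoc]
    constructor
    · intro h z
      have := h (Fin.init z) (z (Fin.last b))
      rwa [Fin.snoc_init_self] at this
    · exact fun h z a => h _

open FirstOrder Language in
theorem quantifierNumber_exs {k : ℕ} (φ : strLang.BoundedFormula Empty k) :
    quantifierNumber φ.exs = quantifierNumber φ + k := by
  induction k with
  | zero => rfl
  | succ k ih =>
    rw [BoundedFormula.exs, ih, BoundedFormula.quantifierNumber_ex]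
    omega

open FirstOrder Language in
/-- A sentence `∃ x₁ … x_k ∀ z₁ … z_b` whose matrix says that the type of the assignment is one of
the types realised in `T`. -/
theorem exists_sentence_of_types {n : ℕ} [NeZero n] (k b : ℕ)
    (T : Set ((Fin n → Bool) × (Fin (k + b) → Fin n))) :
    ∃ φ : strLang.Sentence, quantifierNumber φ = k + b ∧ ∀ w : Fin n → Bool,
      StrModels w φ ↔ ∃ x : Fin k → Fin n, ∀ z : Fin b → Fin n,
        ∃ p ∈ T, SameType w (Fin.append x z) p.1 p.2 := by
  obtain ⟨φ, hq, hφ⟩ : QFDefinable fun w xs => ∃ p : T, SameType w xs p.1.1 p.1.2 :=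
    QFDefinable.exists_of_finite fun p => qfDefinable_sameType _ _
  obtain ⟨ψ, hqψ, hψ⟩ := exists_forall_block φ
  refine ⟨ψ.exs, by rw [quantifierNumber_exs, hqψ, hq]; omega, fun w => ?_⟩
  have : StrModels w ψ.exs ↔ ∃ x, SatAt w ψ x := by
    unfold StrModels Sentence.Realize
    rw [@BoundedFormula.realize_exs _ _ (strStructure w)]
    exact exists_congr fun x => iff_of_eq (congrArg₂ _ (Subsingleton.elim _ _) rfl)
  simp only [this, hψ, hφ, Subtype.exists, exists_prop]

theorem definesFun_iff {n : ℕ} [NeZero n] {φ : strLang.Sentence} {f : (Fin n → Bool) → Bool}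
    (h : ∀ w, StrModels w φ ↔ f w = true) : DefinesFun φ f :=
  ⟨fun w hw => (h w).2 hw, fun w hw hw' => Bool.false_ne_true (hw.symm.trans ((h w).1 hw'))⟩

/-- With `n` increasing variables, `x` must be the identity and its type spells out the whole
string. This handles small `n`. -/
theorem exists_definesFun_length {n : ℕ} [NeZero n] (f : (Fin n → Bool) → Bool) :
    ∃ φ : strLang.Sentence, DefinesFun φ f ∧ quantifierNumber φ = n := by
  obtain ⟨φ, hq, hφ⟩ := exists_sentence_of_types n 0
    {p : (Fin n → Bool) × (Fin n → Fin n) | f p.1 = true ∧ p.2 = id}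
  refine ⟨φ, definesFun_iff fun v => (hφ v).trans ⟨?_, fun h => ?_⟩, hq⟩
  · rintro ⟨x, hx⟩
    obtain ⟨⟨w, _⟩, ⟨hw, rfl⟩, hlt, hbit⟩ := hx Fin.elim0
    rw [Fin.append_elim0] at hlt hbit
    have hmono : StrictMono x := fun i j hij => (hlt i j).2 hij
    have hid : x = id := by
      refine (StrictMono.range_inj hmono strictMono_id).1 ?_
      rw [Set.range_id, (Finite.surjective_of_injective hmono.injective).range_eq]
    subst hid
    have : v = w := funext hbit
    rwa [this]
  · refine ⟨id, fun z => ⟨(v, id), ⟨h, rfl⟩, ?_⟩⟩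
    rw [Subsingleton.elim z Fin.elim0, Fin.append_elim0]
    exact SameType.refl _ _

/-- The map `τ ∘ σ⁻¹` is an order automorphism of a finite chain, hence trivial. -/
theorem perm_eq_of_lt_iff_lt {k : ℕ} {σ τ : Equiv.Perm (Fin k)}
    (h : ∀ i j, σ i < σ j ↔ τ i < τ j) : σ = τ := by
  let e : Fin k ≃o Fin k :=
    { toEquiv := σ.symm.trans τ
      map_rel_iff' := fun {a b} => by
        have := h (σ.symm b) (σ.symm a)
        simp only [Equiv.apply_symm_apply] at this
        simp only [Equiv.trans_apply, ← not_lt, this] }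
  ext i
  have := congrArg (fun e : Fin k ≃o Fin k => e (σ i)) (Subsingleton.elim e (OrderIso.refl _))
  have : τ (σ.symm (σ i)) = σ i := this
  rw [Equiv.symm_apply_apply] at this
  rw [this]

/-! ### Rigidity: a matched string is the given one -/

/-- Every assignment `z` in `v` of `b` further variables can be matched in `w`, relative to the
positions `x` in `v` and `p` in `w`. -/
def Matches {n k : ℕ} (b : ℕ) (v : Fin n → Bool) (x : Fin k → Fin n) (w : Fin n → Bool)
    (p : Fin k → Fin n) : Prop :=
  ∀ z : Fin b → Fin n, ∃ z' : Fin b → Fin n,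
    (∀ i j, x i < z j ↔ p i < z' j) ∧ (∀ i j, z j < x i ↔ z' j < p i) ∧
    (∀ i j, z i < z j ↔ z' i < z' j) ∧ (∀ j, v (z j) = w (z' j))

/-- The probe of the gap after `x j.castSucc`: consecutive positions must be matched by increasing
ones, so the `i`-th answer lies at least `i + 1` beyond `p j.castSucc`. -/
theorem Matches.gap {n K b : ℕ} {v w : Fin n → Bool} {x p : Fin (K + 1) → Fin n}
    (h : Matches b v x w p) (j : Fin K) :
    ∃ z z' : Fin b → Fin n,
      (∀ i, (z i : ℕ) = min ((x j.castSucc : ℕ) + 1 + i) (x j.succ)) ∧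
      (∀ i, v (z i) = w (z' i)) ∧ (∀ i i', z i < z i' → z' i < z' i') ∧
      (∀ i, z i < x j.succ ↔ z' i < p j.succ) ∧
      (∀ i, x j.succ < z i ↔ p j.succ < z' i) ∧
      ∀ i : ℕ, ∀ hi : i < b, (x j.castSucc : ℕ) + 1 + i ≤ x j.succ →
        (p j.castSucc : ℕ) + 1 + i ≤ z' ⟨i, hi⟩ := by
  -- The cap at `x j.succ` lets one `b`-tuple probe gaps of every length up to `b`; surplus
  -- variables pile up on the right end.
  let z : Fin b → Fin n := fun i =>
    ⟨min ((x j.castSucc : ℕ) + 1 + i) (x j.succ), lt_of_le_of_lt (min_le_right _ _) (x j.succ).2⟩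
  obtain ⟨z', h₁, h₂, h₃, h₄⟩ := h z
  refine ⟨z, z', fun _ => rfl, h₄, fun i i' => (h₃ i i').1, fun i => h₂ _ i, fun i => h₁ _ i,
    fun i => ?_⟩
  induction i with
  | zero =>
    intro hi hle
    have : x j.castSucc < z ⟨0, hi⟩ := by
      rw [Fin.lt_def]
      simp only [z]
      omega
    have := Fin.lt_def.1 ((h₁ _ _).1 this)
    omega
  | succ i ih =>
    intro hi hle
    have h₅ := ih (by omega) (by omega)
    have : z ⟨i, by omega⟩ < z ⟨i + 1, hi⟩ := by
      rw [Fin.lt_def]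
      simp only [z]
      omega
    have := Fin.lt_def.1 ((h₃ _ _).1 this)
    omega

/-- Constant probes at the two ends pin down the first and last `x`. No gap of `x` exceeds the
corresponding gap of `p`, or too many points would have to fit inside the latter. The total lengths
agree, so all gaps do. -/
theorem Matches.positions_eq {n K b : ℕ} [NeZero n] {v w : Fin n → Bool}
    {x p : Fin (K + 1) → Fin n} (h : Matches b v x w p) (hb : 0 < b)
    (hp : StrictMono p) (hp0 : (p 0 : ℕ) = 0) (hpl : (p (Fin.last K) : ℕ) + 1 = n)
    (hgap : ∀ j : Fin K, (p j.succ : ℕ) ≤ p j.castSucc + b) : x = p := by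
  have hx0 : (x 0 : ℕ) = 0 := by
    obtain ⟨z', h₁, h₂, -⟩ := h fun _ => p 0
    have h₃ : ¬ z' ⟨0, hb⟩ < p 0 := by rw [Fin.lt_def]; omega
    have h₄ := mt (h₂ 0 ⟨0, hb⟩).1 h₃
    rw [Fin.lt_def] at h₄
    omega
  have hxl : (x (Fin.last K) : ℕ) + 1 = n := by
    obtain ⟨z', h₁, h₂, -⟩ := h fun _ => p (Fin.last K)
    have h₃ : ¬ p (Fin.last K) < z' ⟨0, hb⟩ := by rw [Fin.lt_def]; omega
    have h₄ := mt (h₁ _ ⟨0, hb⟩).1 h₃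
    rw [Fin.lt_def] at h₄
    omega
  -- Monotonicity of `p - x` is the comparison of gaps; as `p - x` vanishes at both ends, it
  -- vanishes everywhere.
  have hmono : Monotone fun j : Fin (K + 1) => ((p j : ℕ) : ℤ) - (x j : ℕ) := by
    rw [Fin.monotone_iff_le_succ]
    intro j
    obtain ⟨z, z', hz, -, -, hlt, -, hle⟩ := h.gap j
    have hpj := Fin.lt_def.1 (hp (Fin.castSucc_lt_succ (i := j)))
    by_contra! hcon
    have hg := hgap j
    have hi : (p j.succ : ℕ) - p j.castSucc - 1 < b := by omega
    have h₅ := hle _ hi (by omega)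
    have h₆ : z ⟨_, hi⟩ < x j.succ := by
      rw [Fin.lt_def, hz]
      simp only
      omega
    have h₇ := Fin.lt_def.1 ((hlt _).1 h₆)
    omega
  funext j
  have h₁ := hmono (Fin.zero_le j)
  have h₂ := hmono (Fin.le_last j)
  simp only [hx0, hp0] at h₁ h₂
  ext
  omega

theorem exists_gap {n K : ℕ} {p : Fin (K + 1) → Fin n} (hp0 : (p 0 : ℕ) = 0) (q : Fin n)
    (j : Fin (K + 1)) (hq : q < p j) : ∃ i : Fin K, p i.castSucc ≤ q ∧ q < p i.succ := by
  induction j using Fin.induction with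
  | zero => rw [Fin.lt_def] at hq; omega
  | succ j ih =>
    by_cases h : q < p j.castSucc
    · exact ih h
    · exact ⟨j, not_lt.1 h, hq⟩

/-- Once `x = p`, a probe filling the gap around `q` leaves its answers no slack: they are squeezed
from both sides onto the same positions, so the bits at `q` agree. -/
theorem Matches.eq {n K b : ℕ} [NeZero n] {v w : Fin n → Bool}
    {x p : Fin (K + 1) → Fin n} (h : Matches b v x w p) (hb : 0 < b)
    (hp : StrictMono p) (hp0 : (p 0 : ℕ) = 0) (hpl : (p (Fin.last K) : ℕ) + 1 = n)
    (hgap : ∀ j : Fin K, (p j.succ : ℕ) ≤ p j.castSucc + b)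
    (hbit : ∀ j, v (x j) = w (p j)) : v = w := by
  obtain rfl := h.positions_eq hb hp hp0 hpl hgap
  funext q
  rcases eq_or_ne q (x (Fin.last K)) with rfl | hne
  · exact hbit _
  have hq : q < x (Fin.last K) := by
    rw [Fin.lt_def]
    have := Fin.val_ne_of_ne hne
    omega
  obtain ⟨j, hj, hj'⟩ := exists_gap hp0 q _ hq
  rcases hj.eq_or_lt with rfl | hj
  · exact hbit _
  obtain ⟨z, z', hz, hv, hlt, -, hend, hle⟩ := h.gap j
  have hg := hgap j
  rw [Fin.lt_def] at hj hj'
  -- The upper half of the squeeze, by descending from the right end of the gap; `c` is the distance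
  -- to it.
  have hupper : ∀ c i : ℕ, ∀ hi : i < b, (x j.castSucc : ℕ) + 1 + i + c = x j.succ →
      (z' ⟨i, hi⟩ : ℕ) + c ≤ x j.succ := by
    intro c
    induction c with
    | zero =>
      intro i hi hic
      have h₁ : ¬ x j.succ < z ⟨i, hi⟩ := by
        rw [Fin.lt_def, hz]
        simp only
        omega
      have := mt (hend _).2 h₁
      rw [Fin.lt_def] at this
      omega
    | succ c ih =>
      intro i hi hic
      have h₁ : z ⟨i, hi⟩ < z ⟨i + 1, by omega⟩ := by
        rw [Fin.lt_def, hz, hz]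
        simp only
        omega
      have h₂ := Fin.lt_def.1 (hlt _ _ h₁)
      have h₃ := ih (i + 1) (by omega) (by omega)
      omega
  have hi : (q : ℕ) - x j.castSucc - 1 < b := by omega
  have h₁ := hle _ hi (by omega)
  have h₂ := hupper ((x j.succ : ℕ) - q) _ hi (by omega)
  have hzq : z ⟨_, hi⟩ = q := by
    ext
    rw [hz]
    simp only
    omega
  have hzq' : z' ⟨_, hi⟩ = q := by
    ext
    omega
  have := hv ⟨_, hi⟩
  rwa [hzq, hzq'] at this

/-! ### The defining sentence -/

theorem exists_definesFun_of_positions {n K b : ℕ} [NeZero n] (f : (Fin n → Bool) → Bool)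
    (hb : 0 < b) {p : Fin (K + 1) → Fin n} (hp : StrictMono p) (hp0 : (p 0 : ℕ) = 0)
    (hpl : (p (Fin.last K) : ℕ) + 1 = n) (hgap : ∀ j : Fin K, (p j.succ : ℕ) ≤ p j.castSucc + b)
    (hfact : 2 ^ n ≤ (K + 1).factorial) :
    ∃ φ : strLang.Sentence, DefinesFun φ f ∧ quantifierNumber φ = K + 1 + b := by
  obtain ⟨σ⟩ : Nonempty ((Fin n → Bool) ↪ Equiv.Perm (Fin (K + 1))) :=
    Function.Embedding.nonempty_of_card_le (by simpa [Fintype.card_perm] using hfact)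
  obtain ⟨φ, hq, hφ⟩ := exists_sentence_of_types (K + 1) b
    {t : (Fin n → Bool) × (Fin (K + 1 + b) → Fin n) |
      f t.1 = true ∧ ∃ z', t.2 = Fin.append (p ∘ σ t.1) z'}
  refine ⟨φ, definesFun_iff fun v => (hφ v).trans ⟨?_, fun h => ?_⟩, hq⟩
  · rintro ⟨x, hx⟩
    have hx' : ∀ z : Fin b → Fin n, ∃ w, f w = true ∧ ∃ z',
        SameType v (Fin.append x z) w (Fin.append (p ∘ σ w) z') := by
      intro z
      obtain ⟨⟨w, y⟩, ⟨hw, z', hy⟩, hs⟩ := hx z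
      exact ⟨w, hw, z', hy ▸ hs⟩
    have horder : ∀ {z : Fin b → Fin n} {w z'}, SameType v (Fin.append x z) w (Fin.append (p ∘ σ w) z') →
        ∀ i j, x i < x j ↔ σ w i < σ w j := by
      intro z w z' hs i j
      have := hs.1 (Fin.castAdd b i) (Fin.castAdd b j)
      simpa only [Fin.append_left, Function.comp, hp.lt_iff_lt] using this
    -- A dummy probe names the candidate `w`; by `huniq` every other probe must name the same one.
    obtain ⟨w, hw, z₀, hs₀⟩ := hx' fun _ => 0
    have huniq : ∀ {z : Fin b → Fin n} {w' z'},
        SameType v (Fin.append x z) w' (Fin.append (p ∘ σ w') z') →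
        w' = w := fun hs => σ.injective
      (perm_eq_of_lt_iff_lt fun i j => (horder hs i j).symm.trans (horder hs₀ i j))
    -- Composing with the inverse of `σ w` lists the existential variables in the order of `p`.
    have hmatch : Matches b v (x ∘ (σ w).symm) w p := by
      intro z
      obtain ⟨w', -, z', hs⟩ := hx' z
      obtain rfl := huniq hs
      refine ⟨z', fun i j => ?_, fun i j => ?_, fun i j => ?_, fun j => ?_⟩
      · have := hs.1 (Fin.castAdd b ((σ w').symm i)) (Fin.natAdd (K + 1) j)
        simpa using this
      · have := hs.1 (Fin.natAdd (K + 1) j) (Fin.castAdd b ((σ w').symm i))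
        simpa using this
      · have := hs.1 (Fin.natAdd (K + 1) i) (Fin.natAdd (K + 1) j)
        simpa using this
      · have := hs.2 (Fin.natAdd (K + 1) j)
        simpa using this
    have hvw : v = w := hmatch.eq hb hp hp0 hpl hgap fun j => by
      have := hs₀.2 (Fin.castAdd b ((σ w).symm j))
      simpa using this
    rwa [hvw]
  · exact ⟨p ∘ σ v, fun z => ⟨(v, Fin.append (p ∘ σ v) z), ⟨h, z, rfl⟩, SameType.refl _ _⟩⟩

theorem exists_definesFun_of_factorial {n K : ℕ} [NeZero n] (f : (Fin n → Bool) → Bool)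
    (hK : 0 < K) (hKn : K + 1 ≤ n) (hfact : 2 ^ n ≤ (K + 1).factorial) :
    ∃ φ : strLang.Sentence, DefinesFun φ f ∧ quantifierNumber φ = K + 1 + ((n - 1) / K + 1) := by
  have hdiv : ∀ j ≤ K, j * (n - 1) / K ≤ n - 1 := fun j hj =>
    (Nat.div_le_div_right (Nat.mul_le_mul_right _ hj)).trans_eq (Nat.mul_div_cancel_left _ hK)
  -- Evenly spread positions from `0` to `n - 1`: distinct because `K ≤ n - 1`, with gaps at most
  -- `(n - 1) / K + 1`.
  let p : Fin (K + 1) → Fin n := fun j =>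
    ⟨j * (n - 1) / K, by have := hdiv j (Nat.lt_succ_iff.1 j.2); omega⟩
  refine exists_definesFun_of_positions f (Nat.succ_pos _) (p := p) ?_ ?_ ?_ ?_ hfact
  · rw [Fin.strictMono_iff_lt_succ]
    intro j
    rw [Fin.lt_def]
    simp only [p, Fin.val_castSucc, Fin.val_succ]
    calc (j : ℕ) * (n - 1) / K < j * (n - 1) / K + 1 := Nat.lt_succ_self _
      _ = (j * (n - 1) + K) / K := (Nat.add_div_right _ hK).symm
      _ ≤ _ := Nat.div_le_div_right (by rw [add_mul]; omega)
  · simp [p]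
  · have := Nat.pos_of_neZero n
    simp only [p, Fin.val_last]
    rw [Nat.mul_div_cancel_left _ hK]
    omega
  · intro j
    simp only [p, Fin.val_castSucc, Fin.val_succ, add_mul, one_mul]
    rw [Nat.div_le_iff_le_mul_add_pred hK]
    have h₁ := Nat.div_add_mod ((j : ℕ) * (n - 1)) K
    have h₂ := Nat.div_add_mod (n - 1) K
    have h₃ := Nat.mod_lt ((j : ℕ) * (n - 1)) hK
    have h₄ := Nat.mod_lt (n - 1) hK
    rw [mul_add, mul_add]
    omega

-- With `l = log n`, take `K = ⌈δ n / l⌉`, where `δ > 1`. As `m! ≥ (m/e)^m` and `n / l ≥ e ·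
-- 2^(l/δ)` eventually, `(K+1)!` is at least `2^((l/δ)(K+1)) ≥ 2^n`.
open Real Filter in
theorem eventually_exists_block_count {ε : ℝ} (hε : 0 < ε) :
    ∀ᶠ n : ℕ in atTop, ∃ K : ℕ, 0 < K ∧ K + 1 ≤ n ∧ 2 ^ n ≤ (K + 1).factorial ∧
      ((K + 1 + ((n - 1) / K + 1) : ℕ) : ℝ) ≤ (1 + ε) * (n / logb 2 n) := by
  have hlogb : Tendsto (fun n : ℕ => logb 2 (n : ℝ)) atTop atTop :=
    (tendsto_logb_atTop one_lt_two).comp tendsto_natCast_atTop_atTop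
  -- Half of `ε` pays for the factorial; the other half absorbs the probes and rounding, at most `l
  -- + 3 ≤ 2l`, by `e₁`.
  set δ : ℝ := 1 + ε / 2 with hδ
  have hδ1 : 1 < δ := by linarith
  have hlog2 : 0 < log 2 := log_pos one_lt_two
  have hc : 0 < 1 - 1 / δ := by
    rw [sub_pos, div_lt_one (by linarith)]
    exact hδ1
  have e₁ : ∀ᶠ l : ℝ in atTop, 4 * l ^ 2 ≤ ε * 2 ^ l := by
    filter_upwards [(isLittleO_pow_exp_pos_mul_atTop 2 hlog2).bound
      (show 0 < ε / 4 by positivity)] with l hl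
    rw [norm_of_nonneg (by positivity), norm_of_nonneg (by positivity),
      ← rpow_def_of_pos two_pos] at hl
    linarith
  have e₂ : ∀ᶠ l : ℝ in atTop, exp 1 * l ≤ 2 ^ (l * (1 - 1 / δ)) := by
    filter_upwards [(isLittleO_pow_exp_pos_mul_atTop 1 (mul_pos hlog2 hc)).bound
      (show 0 < (exp 1)⁻¹ by positivity), eventually_ge_atTop 0] with l hl hl0
    rw [pow_one, norm_of_nonneg hl0, norm_of_nonneg (by positivity), ← div_eq_inv_mul,
      le_div_iff₀ (exp_pos 1)] at hl
    rw [rpow_def_of_pos two_pos, mul_comm (exp 1)]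
    rwa [show log 2 * (l * (1 - 1 / δ)) = log 2 * (1 - 1 / δ) * l by ring]
  filter_upwards [hlogb.eventually e₁, hlogb.eventually e₂,
    hlogb.eventually (eventually_ge_atTop 3), hlogb.eventually (eventually_ge_atTop (2 * δ)),
    eventually_ge_atTop 4] with n h₁ h₂ h₃ h₄ h₅
  have hnpos : (0 : ℝ) < n := by exact_mod_cast (show 0 < n by omega)
  have hn4 : (4 : ℝ) ≤ n := by exact_mod_cast h₅
  set l := logb 2 (n : ℝ) with hl
  have hlpos : 0 < l := by linarith
  have h2l : (2 : ℝ) ^ l = n := rpow_logb two_pos (by norm_num) hnpos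
  rw [h2l] at h₁
  have hnl : 0 < n / l := by positivity
  have hKpos : 0 < ⌈δ * (n / l)⌉₊ := Nat.ceil_pos.2 (by positivity)
  have hKle : δ * (n / l) ≤ (⌈δ * (n / l)⌉₊ : ℝ) := Nat.le_ceil _
  have hKlt : (⌈δ * (n / l)⌉₊ : ℝ) < δ * (n / l) + 1 := Nat.ceil_lt_add_one (by positivity)
  generalize ⌈δ * (n / l)⌉₊ = K at hKpos hKle hKlt
  have hnlK : n / l ≤ K := by nlinarith
  refine ⟨K, hKpos, ?_, ?_, ?_⟩
  · have : δ * (n / l) ≤ n / 2 := by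
      rw [mul_div_assoc', div_le_iff₀ hlpos]
      nlinarith
    have : ((K + 1 : ℕ) : ℝ) ≤ n := by push_cast; linarith
    exact_mod_cast this
  · have hbase : (2 : ℝ) ^ (l / δ) * exp 1 ≤ ((K + 1 : ℕ) : ℝ) := by
      have h₆ : (2 : ℝ) ^ (l / δ) * 2 ^ (l * (1 - 1 / δ)) = n := by
        rw [← rpow_add two_pos, ← h2l]
        congr 1
        ring
      have h₇ : (2 : ℝ) ^ (l / δ) * exp 1 ≤ n / l := by
        rw [le_div_iff₀ hlpos, mul_assoc, ← h₆]
        gcongr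
      push_cast
      linarith
    have hexp : ((K + 1 : ℕ) : ℝ) ^ (K + 1) ≤ exp 1 ^ (K + 1) * (K + 1).factorial := by
      have := pow_div_factorial_le_exp ((K + 1 : ℕ) : ℝ) (Nat.cast_nonneg _) (K + 1)
      rwa [div_le_iff₀ (by exact_mod_cast Nat.factorial_pos _), ← exp_one_pow] at this
    have hpow : (2 : ℝ) ^ n ≤ ((2 : ℝ) ^ (l / δ)) ^ (K + 1) := by
      rw [← rpow_natCast, ← rpow_natCast, ← rpow_mul two_pos.le]
      apply rpow_le_rpow_of_exponent_le one_le_two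
      calc (n : ℝ) = l / δ * (δ * (n / l)) := by field_simp
        _ ≤ _ := by
          gcongr
          push_cast
          linarith
    have h₈ : exp 1 ^ (K + 1) * (2 : ℝ) ^ n ≤ exp 1 ^ (K + 1) * (K + 1).factorial := by
      calc exp 1 ^ (K + 1) * (2 : ℝ) ^ n ≤ exp 1 ^ (K + 1) * ((2 : ℝ) ^ (l / δ)) ^ (K + 1) := by
            gcongr
        _ = (2 ^ (l / δ) * exp 1) ^ (K + 1) := by rw [mul_pow, mul_comm]
        _ ≤ ((K + 1 : ℕ) : ℝ) ^ (K + 1) := by gcongr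
        _ ≤ _ := hexp
    have := le_of_mul_le_mul_left h₈ (by positivity)
    exact_mod_cast this
  · have hdiv : (((n - 1) / K : ℕ) : ℝ) ≤ l := by
      calc (((n - 1) / K : ℕ) : ℝ) ≤ ((n / K : ℕ) : ℝ) := by
            exact_mod_cast Nat.div_le_div_right (Nat.sub_le _ _)
        _ ≤ n / K := Nat.cast_div_le
        _ ≤ l := by
          rw [div_le_iff₀ (by exact_mod_cast hKpos)]
          rwa [div_le_iff₀ hlpos, mul_comm] at hnlK
    have h₉ : 2 * l ≤ ε / 2 * (n / l) := by
      rw [mul_div_assoc', le_div_iff₀ hlpos]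
      nlinarith
    push_cast
    have : (1 + ε) * (n / l) = δ * (n / l) + ε / 2 * (n / l) := by rw [hδ]; ring
    linarith

theorem upper_bound {ε : ℝ} (hε : 0 < ε) :
    ∃ C : ℝ, ∀ (n : ℕ) [NeZero n] (f : (Fin n → Bool) → Bool),
      ∃ φ : strLang.Sentence, DefinesFun φ f ∧
        (quantifierNumber φ : ℝ) ≤ (1 + ε) * ((n : ℝ) / Real.logb 2 (n : ℝ)) + C := by
  obtain ⟨N, hN⟩ := Filter.eventually_atTop.1 (eventually_exists_block_count hε)
  -- For `n` below the threshold `N`, the constant alone covers the `n` quantifiers of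
  -- `exists_definesFun_length`.
  refine ⟨N, fun n _ f => ?_⟩
  by_cases hn : N ≤ n
  · obtain ⟨K, hK, hKn, hfact, hle⟩ := hN n hn
    obtain ⟨φ, hφ, hq⟩ := exists_definesFun_of_factorial f hK hKn hfact
    refine ⟨φ, hφ, ?_⟩
    rw [hq]
    exact hle.trans (le_add_of_nonneg_right (Nat.cast_nonneg N))
  · obtain ⟨φ, hφ, hq⟩ := exists_definesFun_length f
    refine ⟨φ, hφ, ?_⟩
    have hn1 : (1 : ℝ) ≤ n := by exact_mod_cast Nat.pos_of_neZero n
    have h₁ : (0 : ℝ) ≤ (1 + ε) * ((n : ℝ) / Real.logb 2 n) :=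
      mul_nonneg (by linarith) (div_nonneg (by linarith) (Real.logb_nonneg one_lt_two hn1))
    have h₂ : (n : ℝ) ≤ N := by exact_mod_cast (not_le.1 hn).le
    rw [hq]
    linarith

theorem theoremA :
    (∀ ε : ℝ, 0 < ε → ∃ C : ℝ, ∀ (n : ℕ) [NeZero n] (f : (Fin n → Bool) → Bool),
      ∃ φ : strLang.Sentence, DefinesFun φ f ∧
        (quantifierNumber φ : ℝ) ≤ (1 + ε) * ((n : ℝ) / Real.logb 2 (n : ℝ)) + C) ∧
    (∃ N : ℕ, ∀ (n : ℕ) [NeZero n], N ≤ n →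
      ∃ A : Set (Fin n → Bool), A.Nonempty ∧ A ≠ Set.univ ∧
        ∀ φ : strLang.Sentence, Separates φ A Aᶜ →
          (n : ℝ) / Real.logb 2 (n : ℝ) ≤ (quantifierNumber φ : ℝ)) :=
  ⟨fun _ hε => upper_bound hε, lower_bound⟩
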